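/- \textbf{The protocol.} There are $n$ nodes, at most $qn$ of them adversarial (in an arbitrary fixed set); the others are honest and start with arbitrary opinions in $\{0,1\}$. The parameters are $k,m_0,\ell\in\mathbb N$ with $\ell\ge 1$, $1/2<a\le b<1$ and $\beta\in(0,1/2)$. In each round $m=1,2,\dots$ every honest node $j$ sends $k$ queries to independent uniformly chosen nodes (repetitions and self-queries allowed) and receives a number $\eta_m(j)$ of $1$-answers; honest nodes answer with their current opinion (the one after the previous round). After that a common random threshold $X_m$ is revealed, independent of everything before, with $X_1\sim U[a,b]$ and $X_m\sim U[\beta,1-\beta]$ for $m\ge2$. Each honest node without a final opinion adopts opinion $1$ if $\eta_m(j)/k\ge X_m$, and opinion $0$ otherwise. An opinion held by an honest node after each of $\ell$ consecutive rounds, all with index greater than $m_0$, becomes final for that node and never changes again. The adversary is omniscient, may randomize, and controls all answers of adversarial nodes, but does not know the future. A \emph{cautious} adversary fixes, before each round and depending on the past, one opinion for each adversarial node, which is given as the answer to all queries in that round. A \emph{berserk} adversary may answer each query differently, depending on the past and on all queries of the current round (but not on the current threshold). Let $H_i$ be the event that all honest nodes eventually reach the final opinion $i$, let $\mathcal N\in\mathbb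 N\cup\{\infty\}$ be the number of rounds until all honest nodes have a final opinion, and let $\mathcal M=2nk\mathcal N$ be the total number of messages until then ($k$ queries by each of the $n$ nodes per round, and their answers). \textbf{Statement.} Let $0\le q<\beta<1/2$. (i) (Cautious adversary.) There is $C_0>0$, depending only on $q$ and $\beta$, such that for all $C\ge C_0$, all $1/2<a\le b<1$, all $\ell\ge1$ and all choices $m_0=m_0(n)$ with $m_0=\Theta(\ln n/\ln\ln n)$ there are constants $h,K>0$ such that for all sufficiently large $n$ the protocol with $k=\lceil C\ln n\rceil$ satisfies, for every set of at most $qn$ adversarial nodes, all initial opinions, and every strategy of a cautious adversary, \[ \mathbb P\Big[(H_0\cup H_1)\cap\{\mathcal N\le m_0+\ell\}\cap\Big\{\mathcal M\le K\,\frac{n\ln^2 n}{\ln\ln n}\Big\}\Big]\ \ge\ 1-Kn^{-h}. \] (ii) (Berserk adversary.) If moreover $q<1-2\beta$, the same is true for every strategy of a berserk adversary, with $m_0=\Theta(\ln n)$ instead of $m_0=\Theta(\ln n/\ln\ln n)$ and with the bound $\mathcal M\le K\,n\ln^2 n$ on the number of messages. In particular every $q<1/2$ is allowed for a cautious adversary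 (with any $\beta\in(q,1/2)$) and every $q<1/3$ for a berserk one (with $\beta=1/3$); if $q<1/3$, then $\beta=1/3$ works in both cases. -/

import Mathlib

open MeasureTheory ProbabilityTheory Filter Asymptotics

namespace FPC

noncomputable section

/-- The parameters of the protocol: `k` queries per node and round, thresholds uniform on `[a, b]`
in the first round and on `[β, 1 - β]` afterwards, cooling-off period `m₀`, and `ℓ` consecutive
rounds with the same opinion needed to make it final. -/
structure Params where
  k : ℕ
  a : ℝ
  b : ℝ
  β : ℝ
  m₀ : ℕ
  ℓ : ℕ

/-- The addressees of all queries of one round: `Q j i` is the node that node `j` addresses in its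
`i`-th query (repetitions and self-queries are allowed). -/
abbrev Queries (n k : ℕ) := Fin n → Fin k → Fin n

/-- The answers given by adversarial nodes in one round: `R j i` is the answer to the `i`-th query
of node `j` (it is used only if the addressee is adversarial). Opinion `1` is `true`. -/
abbrev Replies (n k : ℕ) := Fin n → Fin k → Bool

/-- The public randomness of one round: the queries, and the common random threshold. -/
abbrev RoundData (n k : ℕ) := Queries n k × ℝ

/-- The uniform distribution on `[lo, hi]` (the point mass if `lo = hi`). -/
def uniformLaw (lo hi : ℝ) : Measure ℝ :=
  (volume.restrict (Set.Icc (0 : ℝ) 1)).map fun t => lo + t * (hi - lo)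

/-- All queries of a round are independent and uniform over all `n` nodes. -/
def queryLaw (n k : ℕ) : Measure (Queries n k) :=
  Measure.pi fun _ => Measure.pi fun _ => uniformOn Set.univ

/-- The law of the round with index `r`, i.e. of the `(r + 1)`-st round. -/
def roundLaw (p : Params) (n r : ℕ) : Measure (RoundData n p.k) :=
  (queryLaw n p.k).prod
    (if r = 0 then uniformLaw p.a p.b else uniformLaw p.β (1 - p.β))

/-- The law of the randomness of all rounds, which are independent. -/
def roundsLaw (p : Params) (n : ℕ) : Measure (ℕ → RoundData n p.k) :=
  Measure.infinitePi (roundLaw p n)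

instance (lo hi : ℝ) : IsProbabilityMeasure (uniformLaw lo hi) := by
  have h : IsProbabilityMeasure ((volume : Measure ℝ).restrict (Set.Icc (0 : ℝ) 1)) :=
    ⟨by simp⟩
  exact Measure.isProbabilityMeasure_map (by fun_prop)

instance (n k : ℕ) [NeZero n] : IsProbabilityMeasure (queryLaw n k) := by
  unfold queryLaw; infer_instance

instance (p : Params) (n r : ℕ) [NeZero n] : IsProbabilityMeasure (roundLaw p n r) := by
  unfold roundLaw; split_ifs <;> infer_instance

instance (p : Params) (n : ℕ) [NeZero n] : IsProbabilityMeasure (roundsLaw p n) := by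
  unfold roundsLaw; infer_instance

/-- A strategy of an omniscient, randomized adversary; `S` carries his private randomness. His
answers in the round with index `m` may depend on `S`, on the queries and thresholds of all `m`
previous rounds (which, with his own answers, determine all opinions), and on all queries of the
current round, but not on the current threshold, which is drawn afterwards. An answer may depend on
the query and not just on its addressee: this is the berserk adversary. -/
structure Strategy (n k : ℕ) (S : Type*) [MeasurableSpace S] where
  reply : (m : ℕ) → S → (Fin m → RoundData n k) → Queries n k → Replies n k
  measurable_reply : ∀ m, Measurable
    fun x : S × (Fin m → RoundData n k) × Queries n k => reply m x.1 x.2.1 x.2.2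

/-- The strategy of the set `A` of adversarial nodes is cautious: before each round starts, an
opinion is chosen for each adversarial node, which gives it as the answer to whoever asks. -/
def Strategy.IsCautious {n k : ℕ} {S : Type*} [MeasurableSpace S]
    (A : Finset (Fin n)) (σ : Strategy n k S) : Prop :=
  ∃ c : (m : ℕ) → S → (Fin m → RoundData n k) → Fin n → Bool,
    (∀ m, Measurable fun x : S × (Fin m → RoundData n k) => c m x.1 x.2) ∧
    ∀ m s h Q j i, Q j i ∈ A → σ.reply m s h Q j i = c m s h (Q j i)

/-- The state of a node after a round: its opinion, and for how many rounds, counted after the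
cooling-off period, it has had this opinion without interruption. -/
structure NodeState where
  opinion : Bool
  streak : ℕ

/-- The number of `1`-opinions that node `j` receives in a round. -/
def ones {n k : ℕ} (A : Finset (Fin n)) (st : Fin n → NodeState)
    (Q : Queries n k) (R : Replies n k) (j : Fin n) : ℕ :=
  (Finset.univ.filter fun i : Fin k =>
    (if Q j i ∈ A then R j i else (st (Q j i)).opinion) = true).card

open Classical in
/-- Round `m` of the protocol for node `j`, from the states `st` after the previous round: queries
`Q`, adversarial answers `R`, threshold `X`. A final opinion is kept. (The result is meaningful for
honest `j` only.) -/
def step {n : ℕ} (p : Params) (A : Finset (Fin n)) (m : ℕ) (st : Fin n → NodeState)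
    (Q : Queries n p.k) (R : Replies n p.k) (X : ℝ) (j : Fin n) : NodeState :=
  if p.ℓ ≤ (st j).streak then st j
  else
    let o : Bool := decide (X ≤ (ones A st Q R j : ℝ) / p.k)
    { opinion := o
      streak := if m ≤ p.m₀ then 0 else if o = (st j).opinion then (st j).streak + 1 else 1 }

section Run

variable {n : ℕ} {S : Type*} [MeasurableSpace S] (p : Params) (A : Finset (Fin n))
  (σ : Strategy n p.k S) (init : Fin n → Bool)

/-- The states of the nodes after `m` rounds, for the initial opinions `init` and the outcome `x`
of the private randomness of the adversary and the randomness of the rounds. -/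
def states (x : S × (ℕ → RoundData n p.k)) : ℕ → Fin n → NodeState
  | 0 => fun j => { opinion := init j, streak := 0 }
  | m + 1 => step p A (m + 1) (states x m) (x.2 m).1
      (σ.reply m x.1 (fun r : Fin m => x.2 r) (x.2 m).1) (x.2 m).2

/-- Node `j` has the final opinion `i` after round `m`. -/
def FinalOpinion (x : S × (ℕ → RoundData n p.k)) (m : ℕ) (j : Fin n) (i : Bool) : Prop :=
  p.ℓ ≤ (states p A σ init x m j).streak ∧ (states p A σ init x m j).opinion = i

/-- The event `H_i`: all honest nodes eventually reach the final opinion `i`. -/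
def consensusOn (i : Bool) : Set (S × (ℕ → RoundData n p.k)) :=
  {x | ∀ j, j ∉ A → ∃ m, FinalOpinion p A σ init x m j i}

/-- The number of rounds until all honest nodes have a final opinion (`⊤` if this never happens). -/
def numRounds (x : S × (ℕ → RoundData n p.k)) : ℕ∞ :=
  ⨅ m ∈ {m : ℕ | ∀ j, j ∉ A → ∃ i, FinalOpinion p A σ init x m j i}, (m : ℕ∞)

/-- The total number of messages until all honest nodes have a final opinion: in each round, each of
the `n` nodes sends `k` queries, and each query gets an answer. -/
def numMessages (x : S × (ℕ → RoundData n p.k)) : ℕ∞ :=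
  numRounds p A σ init x * (2 * n * p.k : ℕ)

/-- All honest nodes reach the same final opinion, within at most `T` rounds, and with at most `M`
messages. -/
def success (T : ℕ) (M : ℝ) : Set (S × (ℕ → RoundData n p.k)) :=
  {x | x ∈ consensusOn p A σ init false ∪ consensusOn p A σ init true ∧
    numRounds p A σ init x ≤ T ∧
    (numMessages p A σ init x : ENNReal) ≤ ENNReal.ofReal M}

end Run

end

end FPC

/-! Once the adversary's past is fixed, the number of `1`-answers at every node lies between the
numbers of its queries to two sets `lo ⊆ hi` that are determined before the queries are drawn and
differ by at most `γ n` nodes (`Sandwiched`). A cautious adversary has `γ = 0`, a berserk one `γ =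
q`.

Two one-round estimates carry the proof, with `ε = (β - q) / 2`. First, by Hoeffding most nodes see
a fraction of ones within `δ` of the interval from `lo.card / n` to `hi.card / n`. A threshold
outside this enlarged interval therefore gives most honest nodes the same opinion. The threshold
hits the interval with probability at most `(γ + 2δ) / (1 - 2β)`, and Markov's inequality bounds the
number of exceptional nodes (`measureReal_not_nearConsensus_le`). Secondly, if at most `ε n` honest
nodes dissent, the expected fraction of ones is outside `[β, 1 - β]` by at least `ε`. Hoeffding and
a union bound over the nodes then make the next round unanimous up to probability `n exp(-2kε²)`
(`measureReal_not_consensus_le`).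

These bounds hold conditionally on every past, so the failure probabilities of the first kind
multiply over the rounds `2, ..., m₀`, and those of the second kind are summed
(`roundsLaw_not_stable_le`). Round `1` is not used. No opinion can become final before round `m₀ +
ℓ`, so until then every node follows the plain threshold rule; unanimity in the last `ℓ` of these
rounds makes the common opinion final.

With `δ = (ln n)^(-1/4)` the one-round failure probability is at most `(ln n)^(-1/8)` for large `n`
in the cautious case, and at most a constant below `1` in the berserk case if `q < 1 - 2β`. The
respective orders of `m₀` are those for which its `(m₀ - 1)`-st power is polynomially small. -/

namespace FPC

/-! ### Concentration of query counts -/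

/-- The number of queries that are addressed to a node of `B`. -/
def hits {n k : ℕ} (B : Finset (Fin n)) (q : Fin k → Fin n) : ℕ :=
  (Finset.univ.filter fun i => q i ∈ B).card

theorem hits_compl {n k : ℕ} (B : Finset (Fin n)) (q : Fin k → Fin n) :
    (hits Bᶜ q : ℝ) = k - hits B q := by
  have h := Finset.card_filter_add_card_filter_not (s := (Finset.univ : Finset (Fin k)))
    (fun i => q i ∈ B)
  simp only [Finset.card_univ, Fintype.card_fin] at h
  have h' : (hits B q : ℝ) + hits Bᶜ q = k := by
    simp only [hits, Finset.mem_compl]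
    exact_mod_cast h
  linarith

/-- Hoeffding's inequality: the centred indicators of the events `q i ∈ B` are independent and
sub-Gaussian with variance proxy `1/4`. -/
theorem measureReal_hits_ge_le {n k : ℕ} [NeZero n] (B : Finset (Fin n)) {t : ℝ} (ht : 0 ≤ t) :
    (Measure.pi fun _ : Fin k => (uniformOn Set.univ : Measure (Fin n))).real
      {q | k * ((B.card : ℝ) / n + t) ≤ hits B q} ≤ Real.exp (-2 * k * t ^ 2) := by
  rcases Nat.eq_zero_or_pos k with rfl | hk
  · simp
  set u : Measure (Fin n) := uniformOn Set.univ
  set f : Fin n → ℝ := fun x => if x ∈ B then 1 else 0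
  have hf : AEMeasurable f u := (Measurable.of_discrete).aemeasurable
  have hint : ∫ x, f x ∂u = (B.card : ℝ) / n := by
    have : f = (B : Set (Fin n)).indicator 1 := by
      ext x; simp [f, Set.indicator]
    rw [this, integral_indicator_one (MeasurableSet.of_discrete), measureReal_def, uniformOn_univ]
    simp
  have hsub : HasSubgaussianMGF (fun x => f x - ∫ x, f x ∂u) ((‖(1 : ℝ) - 0‖₊ / 2) ^ 2) u :=
    hasSubgaussianMGF_of_mem_Icc hf (ae_of_all _ fun x => by
      simp only [f]; split_ifs <;> simp)
  have hind := iIndepFun_pi (μ := fun _ : Fin k => u)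
    (X := fun _ x => f x - ∫ x, f x ∂u) (fun _ => (hf.sub_const _))
  have hsub' : ∀ i ∈ (Finset.univ : Finset (Fin k)),
      HasSubgaussianMGF (fun q : Fin k → Fin n => f (q i) - ∫ x, f x ∂u)
        ((‖(1 : ℝ) - 0‖₊ / 2) ^ 2) (Measure.pi fun _ : Fin k => u) := by
    intro i _
    have hmp := measurePreserving_eval (fun _ : Fin k => u) i
    have h : HasSubgaussianMGF (fun x => f x - ∫ x, f x ∂u) ((‖(1 : ℝ) - 0‖₊ / 2) ^ 2)
        ((Measure.pi fun _ : Fin k => u).map (Function.eval i)) := by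
      rw [hmp.map_eq]
      exact hsub
    exact h.of_map hmp.measurable.aemeasurable
  have key := HasSubgaussianMGF.measure_sum_ge_le_of_iIndepFun hind hsub'
    (ε := k * t) (by positivity)
  refine le_trans (measureReal_mono ?_) (key.trans (le_of_eq ?_))
  · intro q hq
    simp only [Set.mem_ofPred_eq] at hq ⊢
    rw [Finset.sum_sub_distrib, hint]
    have : ∑ i, f (q i) = hits B q := by simp [f, hits]
    rw [this]
    simp only [Finset.sum_const, Finset.card_univ, Fintype.card_fin, nsmul_eq_mul]
    linarith
  -- The exponent is `-(k t)² / (2 · k/4) = -2 k t²`.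
  · congr 1
    simp
    field_simp

theorem measureReal_hits_le_le {n k : ℕ} [NeZero n] (B : Finset (Fin n)) {t : ℝ} (ht : 0 ≤ t) :
    (Measure.pi fun _ : Fin k => (uniformOn Set.univ : Measure (Fin n))).real
      {q | (hits B q : ℝ) ≤ k * ((B.card : ℝ) / n - t)} ≤ Real.exp (-2 * k * t ^ 2) := by
  -- Few hits of `B` are many hits of the complement.
  refine le_trans (measureReal_mono ?_) (measureReal_hits_ge_le Bᶜ ht)
  intro q hq
  simp only [Set.mem_ofPred_eq] at hq ⊢
  have hn : (n : ℝ) ≠ 0 := NeZero.ne _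
  have hc : ((Bᶜ.card : ℕ) : ℝ) = n - B.card := by
    rw [Finset.card_compl, Nat.cast_sub (Finset.card_le_univ B)]; simp
  rw [hits_compl, hc, sub_div, div_self hn]
  linarith

/-- Markov's inequality for the number of events that occur. -/
theorem measureReal_card_gt_le {Ω : Type*} [MeasurableSpace Ω] (P : Measure Ω)
    [IsProbabilityMeasure P] {n : ℕ} [NeZero n] (E : Fin n → Set Ω) (hE : ∀ j, MeasurableSet (E j))
    {ε c : ℝ} (hε : 0 < ε) (hc : ∀ j, P.real (E j) ≤ c) :
    P.real {ω | ε * n < ∑ j, (E j).indicator (1 : Ω → ℝ) ω} ≤ c / ε := by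
  have hn : (0 : ℝ) < n := Nat.cast_pos.2 (NeZero.pos n)
  have hi : ∀ j, Integrable ((E j).indicator (1 : Ω → ℝ)) P := fun j =>
    (integrable_const (1 : ℝ)).indicator (hE j)
  have h1 := mul_meas_ge_le_integral_of_nonneg (μ := P)
    (f := fun ω => ∑ j, (E j).indicator (1 : Ω → ℝ) ω)
    (ae_of_all _ fun ω => Finset.sum_nonneg fun j _ => Set.indicator_nonneg (by simp) ω)
    (integrable_finsetSum _ fun j _ => hi j) (ε * n)
  rw [integral_finsetSum _ fun j _ => hi j] at h1
  have h2 : ∑ j, ∫ ω, (E j).indicator (1 : Ω → ℝ) ω ∂P ≤ n * c := by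
    calc _ ≤ ∑ j : Fin n, c := Finset.sum_le_sum fun j _ => by
          rw [integral_indicator_one (hE j)]; exact hc j
      _ = _ := by simp
  have h3 : P.real {ω | ε * n < ∑ j, (E j).indicator (1 : Ω → ℝ) ω} ≤
      P.real {ω | ε * n ≤ ∑ j, (E j).indicator (1 : Ω → ℝ) ω} :=
    by
    refine measureReal_mono fun ω hω => ?_
    exact le_of_lt (Set.mem_ofPred_eq ▸ hω)
  rw [le_div_iff₀ hε]
  have h4 := mul_le_mul_of_nonneg_left h3 (mul_pos hε hn).le
  have h5 := h4.trans (h1.trans h2)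
  nlinarith

/-! ### The law of the threshold -/

theorem measureReal_uniformLaw_Icc_le {lo hi c d : ℝ} (h : lo < hi) (hcd : c ≤ d) :
    (uniformLaw lo hi).real (Set.Icc c d) ≤ (d - c) / (hi - lo) := by
  have hp : 0 < hi - lo := sub_pos.2 h
  rw [uniformLaw, measureReal_def, Measure.map_apply (by fun_prop) measurableSet_Icc]
  have hs : (fun t => lo + t * (hi - lo)) ⁻¹' Set.Icc c d
      = Set.Icc ((c - lo) / (hi - lo)) ((d - lo) / (hi - lo)) := by
    ext t
    simp only [Set.mem_preimage, Set.mem_Icc, div_le_iff₀ hp, le_div_iff₀ hp]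
    constructor <;> rintro ⟨h1, h2⟩ <;> constructor <;> linarith
  have hv : (volume.restrict (Set.Icc (0 : ℝ) 1)) ((fun t => lo + t * (hi - lo)) ⁻¹' Set.Icc c d)
      ≤ ENNReal.ofReal ((d - c) / (hi - lo)) := by
    refine (Measure.restrict_apply_le _ _).trans ?_
    rw [hs, Real.volume_Icc]
    apply le_of_eq
    congr 1
    ring
  exact ENNReal.toReal_le_of_le_ofReal (div_nonneg (by linarith) hp.le) hv

theorem uniformLaw_compl_Icc {lo hi : ℝ} (h : lo ≤ hi) :
    (uniformLaw lo hi).real (Set.Icc lo hi)ᶜ = 0 := by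
  rw [uniformLaw, measureReal_def, Measure.map_apply (by fun_prop) measurableSet_Icc.compl,
    Measure.restrict_apply ((by fun_prop : Measurable fun t : ℝ => lo + t * (hi - lo))
      measurableSet_Icc.compl)]
  have : ((fun t => lo + t * (hi - lo)) ⁻¹' (Set.Icc lo hi)ᶜ) ∩ Set.Icc 0 1 = ∅ := by
    rw [Set.eq_empty_iff_forall_notMem]
    rintro t ⟨h1, h2, h3⟩
    exact h1 ⟨by nlinarith, by nlinarith⟩
  rw [this]; simp

/-! ### Resampling one coordinate of a product measure -/

theorem measurable_update_prod {E : ℕ → Type*} [∀ r, MeasurableSpace (E r)] (r : ℕ) :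
    Measurable fun z : (∀ i, E i) × E r => Function.update z.1 r z.2 := by
  refine measurable_pi_lambda _ fun i => ?_
  by_cases hi : i = r
  · subst hi; simpa using measurable_snd
  · simp only [Function.update_of_ne hi]; fun_prop

/-- A product measure does not change when one coordinate is drawn anew. -/
theorem infinitePi_map_update {E : ℕ → Type*} [∀ r, MeasurableSpace (E r)]
    (ν : ∀ r, Measure (E r)) [∀ r, IsProbabilityMeasure (ν r)] (r : ℕ) :
    ((Measure.infinitePi ν).prod (ν r)).map (fun z => Function.update z.1 r z.2)
      = Measure.infinitePi ν := by
  classical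
  have hmeas := measurable_update_prod (E := E) r
  refine Measure.eq_infinitePi _ fun s t ht => ?_
  have hms : MeasurableSet (Set.pi (s : Set ℕ) t) :=
    MeasurableSet.pi s.countable_toSet fun i _ => ht i
  rw [Measure.map_apply hmeas hms]
  -- The new draw bears the constraint at `r`, the old sequence bears all others; on such a
  -- rectangle the measure factorizes.
  have hpre : (fun z : (∀ i, E i) × E r => Function.update z.1 r z.2) ⁻¹' Set.pi (s : Set ℕ) t
      = (Set.pi ((s.erase r : Finset ℕ) : Set ℕ) t) ×ˢ (if r ∈ s then t r else Set.univ) := by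
    ext ⟨ω, e⟩
    simp only [Set.mem_preimage, Set.mem_pi, Set.mem_prod, Finset.mem_coe, Finset.mem_erase]
    constructor
    · refine fun h => ⟨fun i hi => by simpa [hi.1] using h i hi.2, ?_⟩
      split_ifs with hr
      · simpa using h r hr
      · trivial
    · rintro ⟨h1, h2⟩ i hi
      by_cases hir : i = r
      · subst hir; simpa [hi] using h2
      · simpa [hir] using h1 i ⟨hir, hi⟩
  rw [hpre, Measure.prod_prod, Measure.infinitePi_pi _ (fun i _ => ht i)]
  split_ifs with hr
  · rw [Finset.prod_erase_mul _ _ hr]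
  · rw [Finset.erase_eq_of_notMem hr]; simp

/-- If the conditional probability of `B` given all coordinates but the `r`-th one is at most `c`,
then it stays so on every event that does not depend on the `r`-th coordinate. -/
theorem infinitePi_inter_le {E : ℕ → Type*} [∀ r, MeasurableSpace (E r)]
    (ν : ∀ r, Measure (E r)) [∀ r, IsProbabilityMeasure (ν r)] (r : ℕ) {G B : Set (∀ i, E i)}
    (hG : MeasurableSet G) (hB : MeasurableSet B)
    (hGr : ∀ ω e, Function.update ω r e ∈ G ↔ ω ∈ G) {c : ENNReal}
    (hc : ∀ ω, ν r {e | Function.update ω r e ∈ B} ≤ c) :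
    Measure.infinitePi ν (G ∩ B) ≤ c * Measure.infinitePi ν G := by
  have hm := measurable_update_prod (E := E) r
  -- After resampling, the inner integral over the new coordinate is at most `c` if `ω ∈ G` and
  -- vanishes otherwise.
  conv_lhs => rw [← infinitePi_map_update ν r]
  rw [Measure.map_apply hm (hG.inter hB), Measure.prod_apply (hm (hG.inter hB)), mul_comm,
    ← lintegral_indicator_const hG c |>.trans (mul_comm _ _)]
  refine lintegral_mono fun ω => ?_
  by_cases hω : ω ∈ G
  · rw [Set.indicator_of_mem hω]
    refine (measure_mono fun e he => ?_).trans (hc ω)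
    exact he.2
  · rw [Set.indicator_of_notMem hω]
    refine le_of_eq ?_
    convert measure_empty (μ := ν r)
    rw [Set.eq_empty_iff_forall_notMem]
    exact fun e he => hω ((hGr ω e).1 he.1)

theorem infinitePi_le {E : ℕ → Type*} [∀ r, MeasurableSpace (E r)]
    (ν : ∀ r, Measure (E r)) [∀ r, IsProbabilityMeasure (ν r)] (r : ℕ) {B : Set (∀ i, E i)}
    (hB : MeasurableSet B) {c : ENNReal}
    (hc : ∀ ω, ν r {e | Function.update ω r e ∈ B} ≤ c) :
    Measure.infinitePi ν B ≤ c := by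
  simpa using infinitePi_inter_le ν r MeasurableSet.univ hB (by simp) hc

/-- The last event is peeled off by `infinitePi_inter_le`, since the earlier ones do not depend on
its coordinate. Coordinate `0` is left out because the first threshold has a different law. -/
theorem infinitePi_iInter_le {E : ℕ → Type*} [∀ r, MeasurableSpace (E r)]
    (ν : ∀ r, Measure (E r)) [∀ r, IsProbabilityMeasure (ν r)] {B : ℕ → Set (∀ i, E i)}
    (hB : ∀ r, MeasurableSet (B r))
    (hBr : ∀ i r, i < r → ∀ ω e, Function.update ω r e ∈ B i ↔ ω ∈ B i) {c : ENNReal} (N : ℕ)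
    (hc : ∀ r, 1 ≤ r → r < N + 1 → ∀ ω, ν r {e | Function.update ω r e ∈ B r} ≤ c) :
    Measure.infinitePi ν (⋂ r ∈ Finset.Ico 1 (N + 1), B r) ≤ c ^ N := by
  induction N with
  | zero => simp
  | succ N ih =>
    have hset : (⋂ r ∈ Finset.Ico 1 (N + 1 + 1), B r)
        = (⋂ r ∈ Finset.Ico 1 (N + 1), B r) ∩ B (N + 1) := by
      ext ω
      simp only [Set.mem_iInter, Finset.mem_Ico, Set.mem_inter_iff]
      constructor
      · exact fun h => ⟨fun i hi => h i ⟨hi.1, by omega⟩, h _ ⟨by omega, by omega⟩⟩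
      · rintro ⟨h1, h2⟩ i hi
        rcases Nat.lt_succ_iff_lt_or_eq.1 hi.2 with h | h
        · exact h1 i ⟨hi.1, h⟩
        · exact h ▸ h2
    rw [hset, pow_succ']
    refine (infinitePi_inter_le ν (N + 1) (Finset.measurableSet_biInter _ fun i _ => hB i)
      (hB _) ?_ (hc (N + 1) (by omega) (by omega))).trans ?_
    · intro ω e
      simp only [Set.mem_iInter, Finset.mem_Ico]
      exact forall₂_congr fun i hi => hBr i (N + 1) hi.2 ω e
    · gcongr
      exact ih fun r h1 h2 => hc r h1 (by omega)

/-! ### Measurability and causality of the states -/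

instance : MeasurableSpace NodeState := ⊤

instance : DiscreteMeasurableSpace NodeState := ⟨fun _ => trivial⟩

instance : Countable NodeState :=
  Function.Injective.countable (f := fun s : NodeState => (s.opinion, s.streak))
    (by rintro ⟨a, b⟩ ⟨c, d⟩ h; simpa using h)

theorem measurable_step {n : ℕ} (p : Params) (A : Finset (Fin n)) (m : ℕ) :
    Measurable fun y : ((Fin n → NodeState) × Queries n p.k × Replies n p.k) × ℝ =>
      step p A m y.1.1 y.1.2.1 y.1.2.2 y.2 := by
  refine measurable_from_prod_countable_right fun z => measurable_pi_lambda _ fun j => ?_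
  have hd : Measurable fun X : ℝ => decide (X ≤ (ones A z.1 z.2.1 z.2.2 j : ℝ) / p.k) := by
    refine measurable_to_bool ?_
    have : (fun X : ℝ => decide (X ≤ (ones A z.1 z.2.1 z.2.2 j : ℝ) / p.k)) ⁻¹' {true}
        = Set.Iic ((ones A z.1 z.2.1 z.2.2 j : ℝ) / p.k) := by
      ext X; simp
    rw [this]; exact measurableSet_Iic
  unfold step
  by_cases h : p.ℓ ≤ (z.1 j).streak
  · simp only [h, if_true]; exact measurable_const
  · simp only [h, if_false]
    exact (Measurable.of_discrete (f := fun o : Bool => ({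
      opinion := o
      streak := if m ≤ p.m₀ then 0 else
        if o = (z.1 j).opinion then (z.1 j).streak + 1 else 1 } : NodeState))).comp hd

theorem step_of_lt {n : ℕ} (p : Params) (A : Finset (Fin n)) (m : ℕ) (st : Fin n → NodeState)
    (Q : Queries n p.k) (R : Replies n p.k) (X : ℝ) (j : Fin n) (h : (st j).streak < p.ℓ) :
    ((step p A m st Q R X j).opinion = true ↔ X ≤ (ones A st Q R j : ℝ) / p.k) ∧
    (step p A m st Q R X j).streak = if m ≤ p.m₀ then 0 else
      if (step p A m st Q R X j).opinion = (st j).opinion then (st j).streak + 1 else 1 := by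
  unfold step
  simp [not_le.2 h]

section Run

variable {n : ℕ} {S : Type*} [MeasurableSpace S] (p : Params) (A : Finset (Fin n))
  (σ : Strategy n p.k S) (init : Fin n → Bool)

theorem measurable_states (m : ℕ) :
    Measurable fun x : S × (ℕ → RoundData n p.k) => states p A σ init x m := by
  induction m with
  | zero => exact measurable_const
  | succ m ih =>
    have hr : Measurable fun x : S × (ℕ → RoundData n p.k) =>
        σ.reply m x.1 (fun r : Fin m => x.2 r) (x.2 m).1 :=
      (σ.measurable_reply m).comp (by fun_prop :
        Measurable fun x : S × (ℕ → RoundData n p.k) =>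
          (x.1, (fun r : Fin m => x.2 r), (x.2 m).1))
    have hq : Measurable fun x : S × (ℕ → RoundData n p.k) => (x.2 m).1 := by fun_prop
    have hx : Measurable fun x : S × (ℕ → RoundData n p.k) => (x.2 m).2 := by fun_prop
    exact (measurable_step p A (m + 1)).comp ((ih.prodMk (hq.prodMk hr)).prodMk hx)

/-- Causality: the first `m` rounds use only the coordinates below `m`. This gives the invariance
under resampling that the product bounds require. -/
theorem states_update_of_le (s : S) (ω : ℕ → RoundData n p.k) (r : ℕ) (e : RoundData n p.k)
    {m : ℕ} (hm : m ≤ r) :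
    states p A σ init (s, Function.update ω r e) m = states p A σ init (s, ω) m := by
  induction m with
  | zero => rfl
  | succ m ih =>
    have h1 : (fun i : Fin m => Function.update ω r e i) = fun i : Fin m => ω i := by
      ext1 i; exact Function.update_of_ne (by omega) _ _
    have h2 : Function.update ω r e m = ω m := Function.update_of_ne (by omega) _ _
    simp only [states, ih (by omega), h1, h2]

theorem states_update_succ (s : S) (ω : ℕ → RoundData n p.k) (r : ℕ) (e : RoundData n p.k) :
    states p A σ init (s, Function.update ω r e) (r + 1)
      = step p A (r + 1) (states p A σ init (s, ω) r) e.1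
        (σ.reply r s (fun i : Fin r => ω i) e.1) e.2 := by
  have h1 : (fun i : Fin r => Function.update ω r e i) = fun i : Fin r => ω i := by
    ext1 i; exact Function.update_of_ne (by omega) _ _
  have h2 : Function.update ω r e r = e := Function.update_self _ _ _
  simp only [states, states_update_of_le p A σ init s ω r e le_rfl, h1, h2]

/-! ### Streaks and finality -/

theorem streak_states_le (x : S × (ℕ → RoundData n p.k)) (m : ℕ) (j : Fin n) :
    (states p A σ init x m j).streak ≤ m - p.m₀ := by
  induction m with
  | zero => simp [states]
  | succ m ih =>
    simp only [states, step]
    split_ifs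
    all_goals try dsimp only
    all_goals omega

/-- This keeps the freezing rule out of the analysis: in every round up to `m₀ + ℓ` the opinions
still follow the threshold. -/
theorem streak_states_lt (x : S × (ℕ → RoundData n p.k)) {m : ℕ} (hℓ : 1 ≤ p.ℓ)
    (hm : m < p.m₀ + p.ℓ) (j : Fin n) : (states p A σ init x m j).streak < p.ℓ := by
  have := streak_states_le p A σ init x m j
  omega

/-- After each of the `ℓ` rounds that follow the cooling-off period, all honest nodes have the same
opinion `i`. -/
def stableOn (i : Bool) : Set (S × (ℕ → RoundData n p.k)) :=
  {x | ∀ t : Fin p.ℓ, ∀ j, j ∉ A → (states p A σ init x (p.m₀ + t + 1) j).opinion = i}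

theorem measurableSet_stableOn (i : Bool) : MeasurableSet (stableOn p A σ init i) := by
  have : stableOn p A σ init i = ⋂ t : Fin p.ℓ,
      (fun x => states p A σ init x (p.m₀ + t + 1)) ⁻¹' {st | ∀ j, j ∉ A → (st j).opinion = i} := by
    ext x; simp [stableOn]
  rw [this]
  exact MeasurableSet.iInter fun t =>
    measurable_states p A σ init _ (Set.to_countable _).measurableSet

theorem finalOpinion_of_mem_stableOn {i : Bool} {x : S × (ℕ → RoundData n p.k)} (hℓ : 1 ≤ p.ℓ)
    (hx : x ∈ stableOn p A σ init i) {j : Fin n} (hj : j ∉ A) :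
    FinalOpinion p A σ init x (p.m₀ + p.ℓ) j i := by
  have hop : ∀ t, t < p.ℓ → (states p A σ init x (p.m₀ + t + 1) j).opinion = i :=
    fun t ht => hx ⟨t, ht⟩ j hj
  have key : ∀ t, t < p.ℓ → (states p A σ init x (p.m₀ + t + 1) j).streak = t + 1 := by
    intro t
    induction t with
    | zero =>
      intro ht
      have hl := streak_states_lt p A σ init x hℓ (m := p.m₀) (by omega) j
      -- The streak is `0` when the cooling-off period ends, so round `m₀ + 1` makes it `1` whether
      -- or not the opinion changes.
      have h0 := streak_states_le p A σ init x p.m₀ j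
      have h := (step_of_lt p A (p.m₀ + 1) (states p A σ init x p.m₀) (x.2 p.m₀).1
        (σ.reply p.m₀ x.1 (fun r : Fin p.m₀ => x.2 r) (x.2 p.m₀).1) (x.2 p.m₀).2 j hl).2
      change (states p A σ init x (p.m₀ + 1) j).streak = _ at h
      rw [add_zero, h]
      split_ifs <;> omega
    | succ t ih =>
      intro ht
      have hl := streak_states_lt p A σ init x hℓ (m := p.m₀ + t + 1) (by omega) j
      have h := (step_of_lt p A (p.m₀ + t + 1 + 1) (states p A σ init x (p.m₀ + t + 1))
        (x.2 (p.m₀ + t + 1)).1 (σ.reply (p.m₀ + t + 1) x.1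
          (fun r : Fin (p.m₀ + t + 1) => x.2 r) (x.2 (p.m₀ + t + 1)).1)
        (x.2 (p.m₀ + t + 1)).2 j hl).2
      change (states p A σ init x (p.m₀ + t + 1 + 1) j).streak =
        if p.m₀ + t + 1 + 1 ≤ p.m₀ then 0 else
        if (states p A σ init x (p.m₀ + t + 1 + 1) j).opinion = _ then _ else _ at h
      rw [if_neg (by omega), hop t (by omega), if_pos (by exact hop (t + 1) ht), ih (by omega)] at h
      exact h
  obtain ⟨t, ht⟩ : ∃ t, p.ℓ = t + 1 := ⟨p.ℓ - 1, by omega⟩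
  have hk := key t (by omega)
  have ho := hop t (by omega)
  rw [FinalOpinion, show p.m₀ + p.ℓ = p.m₀ + t + 1 by omega]
  exact ⟨by omega, ho⟩

theorem stableOn_subset_success (hℓ : 1 ≤ p.ℓ) {M : ℝ}
    (hM : ((p.m₀ + p.ℓ : ℕ) : ℝ) * (2 * n * p.k) ≤ M) (i : Bool) :
    stableOn p A σ init i ⊆ success p A σ init (p.m₀ + p.ℓ) M := by
  intro x hx
  have hfin := fun j hj => finalOpinion_of_mem_stableOn p A σ init hℓ hx (j := j) hj
  have hnum : numRounds p A σ init x ≤ ((p.m₀ + p.ℓ : ℕ) : ℕ∞) :=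
    iInf₂_le (p.m₀ + p.ℓ) (fun j hj => ⟨i, hfin j hj⟩)
  refine ⟨?_, by exact_mod_cast hnum, ?_⟩
  · have : x ∈ consensusOn p A σ init i := fun j hj => ⟨_, hfin j hj⟩
    cases i
    · exact Or.inl this
    · exact Or.inr this
  · have h1 : numMessages p A σ init x ≤ (((p.m₀ + p.ℓ) * (2 * n * p.k) : ℕ) : ℕ∞) := by
      rw [numMessages, Nat.cast_mul]
      exact mul_le_mul_left hnum _
    calc (numMessages p A σ init x : ENNReal)
        ≤ ((((p.m₀ + p.ℓ) * (2 * n * p.k) : ℕ) : ℕ∞) : ENNReal) := by exact_mod_cast h1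
      _ = ENNReal.ofReal (((p.m₀ + p.ℓ) * (2 * n * p.k) : ℕ) : ℝ) := by
          rw [ENNReal.ofReal_natCast, ENat.toENNReal_coe]
      _ ≤ ENNReal.ofReal M := ENNReal.ofReal_le_ofReal (by push_cast at hM ⊢; exact hM)

end Run

/-! ### One round of the protocol -/

section Round

variable {n : ℕ}

/-- All honest nodes but at most `ε n` have the opinion `i`. -/
def NearConsensus (ε : ℝ) (A : Finset (Fin n)) (i : Bool) (st : Fin n → NodeState) : Prop :=
  ((Finset.univ.filter fun j => j ∉ A ∧ (st j).opinion ≠ i).card : ℝ) ≤ ε * n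

/-- Whatever the queries are, the numbers of `1`-answers lie between the numbers of queries to two
sets `lo ⊆ hi` of nodes, which differ by at most `γ n` nodes, all of them adversarial. -/
def Sandwiched {k : ℕ} (γ : ℝ) (A : Finset (Fin n)) (st : Fin n → NodeState)
    (R : Queries n k → Replies n k) : Prop :=
  ∃ lo hi : Finset (Fin n), lo ⊆ hi ∧ (hi.card : ℝ) ≤ lo.card + γ * n ∧
    (∀ j, j ∉ A → (st j).opinion = true → j ∈ lo) ∧
    (∀ j ∈ hi, j ∈ A ∨ (st j).opinion = true) ∧
    ∀ Q j, hits lo (Q j) ≤ ones A st Q (R Q) j ∧ ones A st Q (R Q) j ≤ hits hi (Q j)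

theorem nearConsensus_of_forall {ε : ℝ} (hε : 0 ≤ ε) {A : Finset (Fin n)} {i : Bool}
    {st : Fin n → NodeState} (h : ∀ j, j ∉ A → (st j).opinion = i) : NearConsensus ε A i st := by
  have : (Finset.univ.filter fun j => j ∉ A ∧ (st j).opinion ≠ i) = ∅ :=
    Finset.filter_eq_empty_iff.2 fun j _ hj => hj.2 (h j hj.1)
  rw [NearConsensus, this]
  simp only [Finset.card_empty, Nat.cast_zero]
  positivity

theorem queryLaw_real_eval [NeZero n] (k : ℕ) (j : Fin n) (T : Set (Fin k → Fin n)) :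
    (queryLaw n k).real {Q | Q j ∈ T}
      = (Measure.pi fun _ : Fin k => (uniformOn Set.univ : Measure (Fin n))).real T := by
  have hmp := measurePreserving_eval
    (fun _ : Fin n => Measure.pi fun _ : Fin k => (uniformOn Set.univ : Measure (Fin n))) j
  exact hmp.measureReal_preimage (Set.to_countable T).measurableSet.nullMeasurableSet

theorem nearConsensus_of_card_le {k : ℕ} {ε : ℝ} {A : Finset (Fin n)} {i : Bool}
    {st : Fin n → NodeState} {E : Fin n → Set (Queries n k)} {Q : Queries n k}
    (hE : ∀ j, j ∉ A → (st j).opinion ≠ i → Q ∈ E j)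
    (h : ∑ j, (E j).indicator (1 : Queries n k → ℝ) Q ≤ ε * n) : NearConsensus ε A i st := by
  refine le_trans ?_ h
  rw [Finset.card_filter, Nat.cast_sum]
  refine Finset.sum_le_sum fun j _ => ?_
  by_cases hj : j ∉ A ∧ (st j).opinion ≠ i
  · rw [if_pos hj, Set.indicator_of_mem (hE j hj.1 hj.2)]; simp
  · rw [if_neg hj]
    simpa using Set.indicator_nonneg (s := E j) (f := (1 : Queries n k → ℝ)) (by simp) Q

variable [NeZero n] (p : Params) (A : Finset (Fin n)) (m : ℕ) (st : Fin n → NodeState)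
  (R : Queries n p.k → Replies n p.k)

/-- Unless the threshold is close to the interval of the possible expected answers, most honest
nodes agree after the round. -/
theorem measureReal_not_nearConsensus_le {γ δ ε : ℝ} (hδ : 0 ≤ δ) (hε : 0 < ε)
    (hβ : p.β < 1 / 2) (hk : 0 < p.k) (hst : ∀ j, (st j).streak < p.ℓ)
    (hR : Sandwiched γ A st R) :
    ((queryLaw n p.k).prod (uniformLaw p.β (1 - p.β))).real
      {e | ¬ ∃ i, NearConsensus ε A i (step p A m st e.1 (R e.1) e.2)}
      ≤ (γ + 2 * δ) / (1 - 2 * p.β) + 2 * Real.exp (-2 * p.k * δ ^ 2) / ε := by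
  obtain ⟨lo, hi, hlohi, hcard, -, -, hones⟩ := hR
  have hn : (0 : ℝ) < n := Nat.cast_pos.2 (NeZero.pos n)
  have hk' : (0 : ℝ) < p.k := Nat.cast_pos.2 hk
  set L : ℝ := lo.card / n
  set U : ℝ := hi.card / n
  have hLU : L ≤ U := by
    have : (lo.card : ℝ) ≤ hi.card := by exact_mod_cast Finset.card_le_card hlohi
    exact div_le_div_of_nonneg_right this hn.le
  have hUL : U ≤ L + γ := by
    simp only [U, L]
    rw [div_add' _ _ _ hn.ne']
    exact div_le_div_of_nonneg_right hcard hn.le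
  set E₁ : Fin n → Set (Queries n p.k) := fun j => {Q | Q j ∈ {q | (hits lo q : ℝ) ≤ p.k * (L - δ)}}
  set E₂ : Fin n → Set (Queries n p.k) := fun j => {Q | Q j ∈ {q | p.k * (U + δ) ≤ (hits hi q : ℝ)}}
  set D₁ : Set (Queries n p.k) := {Q | ε * n < ∑ j, (E₁ j).indicator (1 : Queries n p.k → ℝ) Q}
  set D₂ : Set (Queries n p.k) := {Q | ε * n < ∑ j, (E₂ j).indicator (1 : Queries n p.k → ℝ) Q}
  have h₁ : (queryLaw n p.k).real D₁ ≤ Real.exp (-2 * p.k * δ ^ 2) / ε :=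
    measureReal_card_gt_le _ E₁ (fun j => (Set.to_countable _).measurableSet) hε fun j => by
      rw [queryLaw_real_eval]; exact measureReal_hits_le_le lo hδ
  have h₂ : (queryLaw n p.k).real D₂ ≤ Real.exp (-2 * p.k * δ ^ 2) / ε :=
    measureReal_card_gt_le _ E₂ (fun j => (Set.to_countable _).measurableSet) hε fun j => by
      rw [queryLaw_real_eval]; exact measureReal_hits_ge_le hi hδ
  have h₃ : (uniformLaw p.β (1 - p.β)).real (Set.Icc (L - δ) (U + δ))
      ≤ (γ + 2 * δ) / (1 - 2 * p.β) := by
    refine (measureReal_uniformLaw_Icc_le (by linarith) (by linarith)).trans ?_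
    rw [show 1 - p.β - p.β = 1 - 2 * p.β by ring]
    exact div_le_div_of_nonneg_right (by linarith) (by linarith)
  -- The critical interval depends only on `lo` and `hi`, hence neither on the queries nor on the
  -- threshold. Off the three bad events the side on which the threshold falls decides the opinion
  -- of most nodes.
  have hsub : {e : Queries n p.k × ℝ |
        ¬ ∃ i, NearConsensus ε A i (step p A m st e.1 (R e.1) e.2)}
      ⊆ (Set.univ ×ˢ Set.Icc (L - δ) (U + δ)) ∪ ((D₁ ×ˢ Set.univ) ∪ (D₂ ×ˢ Set.univ)) := by
    rintro ⟨Q, X⟩ hnot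
    by_contra hmem
    simp only [Set.mem_union, Set.mem_prod, Set.mem_univ, true_and, and_true, not_or,
      Set.mem_Icc] at hmem
    obtain ⟨hX, hD₁, hD₂⟩ := hmem
    refine hnot ?_
    rcases lt_or_ge X (L - δ) with hlt | hge
    · refine ⟨true, nearConsensus_of_card_le (E := E₁) (Q := Q) ?_ (not_lt.1 hD₁)⟩
      intro j _ hj
      rw [Ne, (step_of_lt p A m st Q (R Q) X j (hst j)).1, not_le, div_lt_iff₀ hk'] at hj
      have h := (hones Q j).1
      have h' : (hits lo (Q j) : ℝ) ≤ ones A st Q (R Q) j := by exact_mod_cast h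
      change (hits lo (Q j) : ℝ) ≤ p.k * (L - δ)
      nlinarith
    · have hgt : U + δ < X := by
        by_contra h; exact hX ⟨hge, not_lt.1 h⟩
      refine ⟨false, nearConsensus_of_card_le (E := E₂) (Q := Q) ?_ (not_lt.1 hD₂)⟩
      intro j _ hj
      rw [Ne, Bool.not_eq_false, (step_of_lt p A m st Q (R Q) X j (hst j)).1,
        le_div_iff₀ hk'] at hj
      have h := (hones Q j).2
      have h' : (ones A st Q (R Q) j : ℝ) ≤ hits hi (Q j) := by exact_mod_cast h
      change p.k * (U + δ) ≤ (hits hi (Q j) : ℝ)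
      nlinarith
  refine (measureReal_mono hsub).trans ((measureReal_union_le _ _).trans ?_)
  refine (add_le_add_right (measureReal_union_le _ _) _).trans ?_
  simp only [measureReal_prod_prod, probReal_univ, one_mul, mul_one]
  rw [mul_div_assoc, two_mul (Real.exp _ / ε)]
  linarith

/-- From near consensus to full consensus in one round. -/
theorem measureReal_not_consensus_le {q γ : ℝ} (hqβ : q < p.β)
    (hβ : p.β < 1 / 2) (hk : 0 < p.k) (hA : (A.card : ℝ) ≤ q * n)
    (hst : ∀ j, (st j).streak < p.ℓ) (hR : Sandwiched γ A st R) (i : Bool)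
    (hi : NearConsensus ((p.β - q) / 2) A i st) :
    ((queryLaw n p.k).prod (uniformLaw p.β (1 - p.β))).real
      {e | ¬ ∀ j, j ∉ A → (step p A m st e.1 (R e.1) e.2 j).opinion = i}
      ≤ n * Real.exp (-2 * p.k * ((p.β - q) / 2) ^ 2) := by
  obtain ⟨lo, hi', -, -, hlo, hhi, hones⟩ := hR
  have hn : (0 : ℝ) < n := Nat.cast_pos.2 (NeZero.pos n)
  have hk' : (0 : ℝ) < p.k := Nat.cast_pos.2 hk
  set ε := (p.β - q) / 2 with hεdef
  have hε : 0 ≤ ε := by simp only [ε]; linarith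
  -- Both opinions need the same argument: an event `E j` on the queries of node `j` alone, which
  -- contains every failure at `j` when the threshold is in `[β, 1 - β]`.
  suffices h : ∃ E : Fin n → Set (Fin p.k → Fin n),
      (∀ j, (Measure.pi fun _ : Fin p.k => (uniformOn Set.univ : Measure (Fin n))).real (E j)
        ≤ Real.exp (-2 * p.k * ε ^ 2)) ∧
      ∀ Q X j, p.β ≤ X → X ≤ 1 - p.β → (step p A m st Q (R Q) X j).opinion ≠ i → Q j ∈ E j by
    obtain ⟨E, hE, hstep⟩ := h
    have hsub : {e : Queries n p.k × ℝ |
          ¬ ∀ j, j ∉ A → (step p A m st e.1 (R e.1) e.2 j).opinion = i}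
        ⊆ (Set.univ ×ˢ (Set.Icc p.β (1 - p.β))ᶜ) ∪ ((⋃ j, {Q | Q j ∈ E j}) ×ˢ Set.univ) := by
      rintro ⟨Q, X⟩ hnot
      by_contra hmem
      simp only [Set.mem_union, Set.mem_prod, Set.mem_univ, true_and, and_true, not_or,
        Set.mem_compl_iff, not_not, Set.mem_iUnion, not_exists] at hmem
      refine hnot fun j _ => ?_
      by_contra hj
      exact hmem.2 j (hstep Q X j hmem.1.1 hmem.1.2 hj)
    refine (measureReal_mono hsub).trans ((measureReal_union_le _ _).trans ?_)
    simp only [measureReal_prod_prod, probReal_univ, one_mul, mul_one]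
    rw [uniformLaw_compl_Icc (by linarith), zero_add]
    refine (measureReal_iUnion_fintype_le _).trans ?_
    calc _ ≤ ∑ j : Fin n, Real.exp (-2 * p.k * ε ^ 2) :=
          Finset.sum_le_sum fun j _ => by rw [queryLaw_real_eval]; exact hE j
      _ = _ := by simp
  rw [NearConsensus] at hi
  cases i with
  | true =>
    have hcard : 1 - q - ε ≤ (lo.card : ℝ) / n := by
      have hcov : (Finset.univ : Finset (Fin n)) ⊆ lo ∪ (A ∪ Finset.univ.filter fun j =>
          j ∉ A ∧ (st j).opinion ≠ true) := by
        intro j _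
        simp only [Finset.mem_union, Finset.mem_filter, Finset.mem_univ, true_and]
        by_cases h1 : j ∈ A
        · exact Or.inr (Or.inl h1)
        · by_cases h2 : (st j).opinion = true
          · exact Or.inl (hlo j h1 h2)
          · exact Or.inr (Or.inr ⟨h1, h2⟩)
      have h := (Finset.card_le_card hcov).trans ((Finset.card_union_le _ _).trans
        (Nat.add_le_add_left (Finset.card_union_le _ _) _))
      rw [Finset.card_univ, Fintype.card_fin] at h
      have h' : (n : ℝ) ≤ lo.card + (A.card + (Finset.univ.filter fun j =>
          j ∉ A ∧ (st j).opinion ≠ true).card) := by exact_mod_cast h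
      rw [le_div_iff₀ hn]
      linarith
    refine ⟨fun _ => {q | (hits lo q : ℝ) ≤ p.k * ((lo.card : ℝ) / n - ε)},
      fun _ => measureReal_hits_le_le lo hε, fun Q X j _ hX hj => ?_⟩
    rw [Ne, (step_of_lt p A m st Q (R Q) X j (hst j)).1, not_le, div_lt_iff₀ hk'] at hj
    have h' : (hits lo (Q j) : ℝ) ≤ ones A st Q (R Q) j := by exact_mod_cast (hones Q j).1
    change (hits lo (Q j) : ℝ) ≤ p.k * ((lo.card : ℝ) / n - ε)
    -- The choice of `ε` gives `1 - q - 2 * ε = 1 - β`: one `ε` pays for the dissenting nodes, the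
    -- other for the fluctuation of the queries.
    have : X ≤ (lo.card : ℝ) / n - ε := by linarith
    nlinarith
  | false =>
    have hcard : (hi'.card : ℝ) / n ≤ q + ε := by
      have hcov : hi' ⊆ A ∪ Finset.univ.filter fun j => j ∉ A ∧ (st j).opinion ≠ false := by
        intro j hj
        simp only [Finset.mem_union, Finset.mem_filter, Finset.mem_univ, true_and]
        by_cases h1 : j ∈ A
        · exact Or.inl h1
        · exact Or.inr ⟨h1, by simp [(hhi j hj).resolve_left h1]⟩
      have h := (Finset.card_le_card hcov).trans (Finset.card_union_le _ _)
      have h' : (hi'.card : ℝ) ≤ A.card + (Finset.univ.filter fun j =>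
          j ∉ A ∧ (st j).opinion ≠ false).card := by exact_mod_cast h
      rw [div_le_iff₀ hn]
      linarith
    refine ⟨fun _ => {q | p.k * ((hi'.card : ℝ) / n + ε) ≤ (hits hi' q : ℝ)},
      fun _ => measureReal_hits_ge_le hi' hε, fun Q X j hX _ hj => ?_⟩
    rw [Ne, Bool.not_eq_false, (step_of_lt p A m st Q (R Q) X j (hst j)).1,
      le_div_iff₀ hk'] at hj
    have h' : (ones A st Q (R Q) j : ℝ) ≤ hits hi' (Q j) := by exact_mod_cast (hones Q j).2
    change p.k * ((hi'.card : ℝ) / n + ε) ≤ (hits hi' (Q j) : ℝ)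
    have : (hi'.card : ℝ) / n + ε ≤ X := by linarith
    nlinarith

end Round

/-! ### The gap left by the two kinds of adversary -/

theorem sandwiched_of_isCautious {n k : ℕ} {S : Type*} [MeasurableSpace S] {A : Finset (Fin n)}
    {σ : Strategy n k S} (hσ : σ.IsCautious A) (st : Fin n → NodeState) (m : ℕ) (s : S)
    (h : Fin m → RoundData n k) : Sandwiched 0 A st (σ.reply m s h) := by
  obtain ⟨c, -, hc⟩ := hσ
  -- The nodes that answer `1` are settled before the queries are drawn, so this set serves as both
  -- `lo` and `hi`.
  set B : Finset (Fin n) :=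
    Finset.univ.filter fun v => (if v ∈ A then c m s h v else (st v).opinion) = true
  have hB : ∀ Q j, ones A st Q (σ.reply m s h Q) j = hits B (Q j) := by
    intro Q j
    rw [ones, hits]
    congr 1
    refine Finset.filter_congr fun i _ => ?_
    simp only [B, Finset.mem_filter, Finset.mem_univ, true_and]
    by_cases hA : Q j i ∈ A
    · simp only [hA, if_true, hc m s h Q j i hA]
    · simp only [hA, if_false]
  refine ⟨B, B, subset_rfl, by simp, fun j h1 h2 => by simp [B, h1, h2], fun j hj => ?_,
    fun Q j => ⟨(hB Q j).ge, (hB Q j).le⟩⟩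
  by_cases h1 : j ∈ A
  · exact Or.inl h1
  · exact Or.inr (by simpa [B, h1] using hj)

theorem sandwiched_of_card_le {n k : ℕ} {A : Finset (Fin n)} {q : ℝ} (hA : (A.card : ℝ) ≤ q * n)
    (st : Fin n → NodeState) (R : Queries n k → Replies n k) : Sandwiched q A st R := by
  -- The extremes are that all adversarial answers are `0`, or that all are `1`.
  set B : Finset (Fin n) := Finset.univ.filter fun v => v ∉ A ∧ (st v).opinion = true
  refine ⟨B, B ∪ A, Finset.subset_union_left, ?_, fun j h1 h2 => by simp [B, h1, h2],
    fun j hj => ?_, fun Q j => ⟨?_, ?_⟩⟩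
  · have h : ((B ∪ A).card : ℝ) ≤ B.card + A.card := by exact_mod_cast Finset.card_union_le B A
    linarith
  · simp only [B, Finset.mem_union, Finset.mem_filter, Finset.mem_univ, true_and] at hj
    tauto
  · refine Finset.card_le_card (Finset.monotone_filter_right _ fun i _ hi => ?_)
    simp only [B, Finset.mem_filter, Finset.mem_univ, true_and] at hi
    simp [hi.1, hi.2]
  · refine Finset.card_le_card (Finset.monotone_filter_right _ fun i _ hi => ?_)
    simp only [B, Finset.mem_union, Finset.mem_filter, Finset.mem_univ, true_and]
    by_cases h1 : Q j i ∈ A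
    · exact Or.inr h1
    · exact Or.inl ⟨h1, by simpa [h1] using hi⟩

/-! ### All rounds together -/

section Run

variable {n : ℕ} {S : Type*} [MeasurableSpace S] (p : Params) (A : Finset (Fin n))
  (σ : Strategy n p.k S) (init : Fin n → Bool)

/-- Unanimity is in particular near consensus, so `hkeep` applies again after each round. As `r ≤
m₀`, unanimity has been reached by round `m₀ + 1`. -/
theorem mem_stableOn_of_nearConsensus {ε : ℝ} (hε : 0 ≤ ε) (x : S × (ℕ → RoundData n p.k))
    (hkeep : ∀ i r, 1 ≤ r → r < p.m₀ + p.ℓ → NearConsensus ε A i (states p A σ init x r) →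
      ∀ j, j ∉ A → (states p A σ init x (r + 1) j).opinion = i)
    {i : Bool} {r : ℕ} (hr : 1 ≤ r) (hrm : r ≤ p.m₀)
    (hnear : NearConsensus ε A i (states p A σ init x r)) : x ∈ stableOn p A σ init i := by
  have key : ∀ d, r + d < p.m₀ + p.ℓ →
      ∀ j, j ∉ A → (states p A σ init x (r + d + 1) j).opinion = i := by
    intro d
    induction d with
    | zero => exact fun hd => hkeep i r hr hd hnear
    | succ d ih =>
      exact fun hd => hkeep i (r + d + 1) (by omega) hd
        (nearConsensus_of_forall hε (ih (by omega)))
  intro t j hj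
  have h := key (p.m₀ + t - r) (by omega) j hj
  rwa [show r + (p.m₀ + t - r) + 1 = p.m₀ + t + 1 by omega] at h

theorem roundLaw_of_pos {r : ℕ} (hr : 1 ≤ r) :
    roundLaw p n r = (queryLaw n p.k).prod (uniformLaw p.β (1 - p.β)) := by
  rw [roundLaw, if_neg (by omega)]

/-- For fixed private randomness, failure means that near consensus never occurs after the rounds
`2, ..., m₀`, or that some near consensus is not followed by unanimity. The first event contributes
the power, the second a union bound over rounds and both opinions. -/
theorem roundsLaw_not_stable_le [NeZero n] {q γ δ : ℝ} (hδ : 0 ≤ δ) (hqβ : q < p.β)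
    (hβ : p.β < 1 / 2) (hk : 0 < p.k) (hℓ : 1 ≤ p.ℓ) (hA : (A.card : ℝ) ≤ q * n) (s : S)
    (hσ : ∀ st m (h : Fin m → RoundData n p.k), Sandwiched γ A st (σ.reply m s h)) :
    roundsLaw p n {ω | (s, ω) ∉ stableOn p A σ init false ∪ stableOn p A σ init true}
      ≤ ENNReal.ofReal ((γ + 2 * δ) / (1 - 2 * p.β)
          + 2 * Real.exp (-2 * p.k * δ ^ 2) / ((p.β - q) / 2)) ^ (p.m₀ - 1)
        + 2 * (p.m₀ + p.ℓ : ℕ) *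
          ENNReal.ofReal (n * Real.exp (-2 * p.k * ((p.β - q) / 2) ^ 2)) := by
  set ε := (p.β - q) / 2 with hεdef
  have hε : 0 < ε := by simp only [ε]; linarith
  set ρ := (γ + 2 * δ) / (1 - 2 * p.β) + 2 * Real.exp (-2 * p.k * δ ^ 2) / ε
  set κ := n * Real.exp (-2 * p.k * ε ^ 2)
  set F : Set (ℕ → RoundData n p.k) :=
    -- Coordinate `r` drives round `r + 1`. For `m₀ ≤ 1` the intersection is the whole space and the
    -- power in the bound is `1`.
    ⋂ r ∈ Finset.Ico 1 (p.m₀ - 1 + 1),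
      {ω | ¬ ∃ i, NearConsensus ε A i (states p A σ init (s, ω) (r + 1))}
  set D : Bool → ℕ → Set (ℕ → RoundData n p.k) := fun i r =>
    {ω | NearConsensus ε A i (states p A σ init (s, ω) r) ∧
      ¬ ∀ j, j ∉ A → (states p A σ init (s, ω) (r + 1) j).opinion = i}
  have hms : ∀ r, Measurable fun ω => states p A σ init (s, ω) r := fun r =>
    (measurable_states p A σ init r).comp measurable_prodMk_left
  have hmst : ∀ r (T : Set (Fin n → NodeState)),
      MeasurableSet {ω | states p A σ init (s, ω) r ∈ T} := fun r T =>
    hms r (Set.to_countable T).measurableSet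
  have hsub : {ω | (s, ω) ∉ stableOn p A σ init false ∪ stableOn p A σ init true}
      ⊆ F ∪ ⋃ i, ⋃ r ∈ Finset.Ico 1 (p.m₀ + p.ℓ), D i r := by
    intro ω hω
    by_contra hmem
    simp only [Set.mem_union, not_or, F, Set.mem_iInter, Set.mem_iUnion, not_forall,
      not_exists] at hmem
    obtain ⟨⟨r, hr, hnear⟩, hD⟩ := hmem
    rw [Finset.mem_Ico] at hr
    obtain ⟨i, hi⟩ : ∃ i, NearConsensus ε A i (states p A σ init (s, ω) (r + 1)) := by
      by_contra h
      exact hnear (not_exists.1 h)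
    have hst := mem_stableOn_of_nearConsensus p A σ init hε.le (s, ω) (fun i' r' h1 h2 h3 => by
      by_contra h4
      exact hD i' r' (Finset.mem_Ico.2 ⟨h1, h2⟩) ⟨h3, h4⟩) (by omega) (by omega) hi
    apply hω
    cases i
    · exact Or.inl hst
    · exact Or.inr hst
  have hF : roundsLaw p n F ≤ ENNReal.ofReal ρ ^ (p.m₀ - 1) := by
    refine infinitePi_iInter_le (roundLaw p n) (fun r => hmst (r + 1)
      {st | ¬ ∃ i, NearConsensus ε A i st}) ?_ (p.m₀ - 1) ?_
    · intro i r hir ω e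
      simp only [Set.mem_ofPred_eq]
      rw [states_update_of_le p A σ init s ω r e (m := i + 1) hir]
    · intro r hr hrm ω
      have h := measureReal_not_nearConsensus_le p A (r + 1) (states p A σ init (s, ω) r)
        (σ.reply r s fun i : Fin r => ω i) hδ hε hβ hk
        (streak_states_lt p A σ init (s, ω) hℓ (by omega)) (hσ _ _ _)
      rw [roundLaw_of_pos p hr]
      simp only [Set.mem_ofPred_eq, states_update_succ]
      exact (ENNReal.le_ofReal_iff_toReal_le (measure_ne_top _ _)
        (measureReal_nonneg.trans h)).2 h
  have hDb : ∀ i r, r ∈ Finset.Ico 1 (p.m₀ + p.ℓ) → roundsLaw p n (D i r) ≤ ENNReal.ofReal κ := by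
    intro i r hr
    rw [Finset.mem_Ico] at hr
    refine infinitePi_le (roundLaw p n) r ((hmst r {st | NearConsensus ε A i st}).inter
      (hmst (r + 1) {st | ¬ ∀ j, j ∉ A → (st j).opinion = i})) fun ω => ?_
    rw [roundLaw_of_pos p hr.1]
    by_cases hi : NearConsensus ε A i (states p A σ init (s, ω) r)
    · have h := measureReal_not_consensus_le p A (r + 1) (states p A σ init (s, ω) r)
        (σ.reply r s fun i : Fin r => ω i) hqβ hβ hk hA
        (streak_states_lt p A σ init (s, ω) hℓ hr.2) (hσ _ _ _) i hi
      refine (measure_mono ?_).trans ((ENNReal.le_ofReal_iff_toReal_le (measure_ne_top _ _)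
        (measureReal_nonneg.trans h)).2 h)
      intro e he
      have he' := he.2
      simp only [Set.mem_ofPred_eq, states_update_succ] at he' ⊢
      exact he'
    -- The state before the round does not feel the resampling, so without near consensus there the
    -- section is empty.
    · refine (measure_mono_null ?_ measure_empty).le.trans zero_le
      intro e he
      have he' := he.1
      simp only [Set.mem_ofPred_eq] at he'
      rw [states_update_of_le p A σ init s ω r e le_rfl] at he'
      exact hi he'
  refine (measure_mono hsub).trans ((measure_union_le _ _).trans (add_le_add hF ?_))
  refine (measure_iUnion_fintype_le _ _).trans ?_
  calc _ ≤ ∑ i : Bool, ∑ r ∈ Finset.Ico 1 (p.m₀ + p.ℓ), ENNReal.ofReal κ :=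
        Finset.sum_le_sum fun i _ => (measure_biUnion_finset_le _ _).trans
          (Finset.sum_le_sum fun r hr => hDb i r hr)
    _ = 2 * ((p.m₀ + p.ℓ - 1 : ℕ) * ENNReal.ofReal κ) := by simp
    _ ≤ _ := by
        rw [mul_assoc]
        gcongr
        omega

/-- The probability of failure, for strategies whose answers leave a gap of at most `γ`. -/
theorem measureReal_compl_success_le [NeZero n] (μ : Measure S) [IsProbabilityMeasure μ] {q γ δ M : ℝ}
    (hγ : 0 ≤ γ) (hδ : 0 ≤ δ) (hqβ : q < p.β) (hβ : p.β < 1 / 2) (hk : 0 < p.k) (hℓ : 1 ≤ p.ℓ)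
    (hA : (A.card : ℝ) ≤ q * n) (hM : ((p.m₀ + p.ℓ : ℕ) : ℝ) * (2 * n * p.k) ≤ M)
    (hσ : ∀ s st m (h : Fin m → RoundData n p.k), Sandwiched γ A st (σ.reply m s h)) :
    (μ.prod (roundsLaw p n)).real (success p A σ init (p.m₀ + p.ℓ) M)ᶜ
      ≤ ((γ + 2 * δ) / (1 - 2 * p.β)
          + 2 * Real.exp (-2 * p.k * δ ^ 2) / ((p.β - q) / 2)) ^ (p.m₀ - 1)
        + 2 * (p.m₀ + p.ℓ : ℕ) * (n * Real.exp (-2 * p.k * ((p.β - q) / 2) ^ 2)) := by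
  set ρ := (γ + 2 * δ) / (1 - 2 * p.β) + 2 * Real.exp (-2 * p.k * δ ^ 2) / ((p.β - q) / 2)
    with hρdef
  set κ := n * Real.exp (-2 * p.k * ((p.β - q) / 2) ^ 2) with hκdef
  have hρ : 0 ≤ ρ := by
    have h1 : 0 < 1 - 2 * p.β := by linarith
    have h2 : 0 < (p.β - q) / 2 := by linarith
    positivity
  have hκ : 0 ≤ κ := by positivity
  set G := stableOn p A σ init false ∪ stableOn p A σ init true
  have hG : MeasurableSet G :=
    (measurableSet_stableOn p A σ init false).union (measurableSet_stableOn p A σ init true)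
  -- Passing to the measurable set `G` allows Fubini without measurability of `success`.
  have hsub : (success p A σ init (p.m₀ + p.ℓ) M)ᶜ ⊆ Gᶜ :=
    Set.compl_subset_compl.2 (Set.union_subset (stableOn_subset_success p A σ init hℓ hM false)
      (stableOn_subset_success p A σ init hℓ hM true))
  refine ENNReal.toReal_le_of_le_ofReal (by positivity) ((measure_mono hsub).trans ?_)
  rw [Measure.prod_apply hG.compl]
  calc _ ≤ ∫⁻ _, (ENNReal.ofReal ρ ^ (p.m₀ - 1)
          + 2 * (p.m₀ + p.ℓ : ℕ) * ENNReal.ofReal κ) ∂μ :=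
        lintegral_mono fun s => roundsLaw_not_stable_le p A σ init hδ hqβ hβ hk hℓ hA s (hσ s)
    _ = ENNReal.ofReal ρ ^ (p.m₀ - 1) + 2 * (p.m₀ + p.ℓ : ℕ) * ENNReal.ofReal κ := by simp
    _ = _ := by
        clear_value ρ κ
        rw [ENNReal.ofReal_add (by positivity) (by positivity), ENNReal.ofReal_pow hρ,
          ENNReal.ofReal_mul (by positivity), ENNReal.ofReal_mul (by norm_num),
          ENNReal.ofReal_natCast, ENNReal.ofReal_ofNat]

end Run

/-! ### Asymptotics in `n` -/

theorem exp_neg_le_inv {y : ℝ} (hy : 0 < y) : Real.exp (-y) ≤ y⁻¹ := by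
  rw [Real.exp_neg]
  exact inv_anti₀ hy (by linarith [Real.add_one_le_exp y])

theorem tendsto_log_natCast : Tendsto (fun n : ℕ => Real.log n) atTop atTop :=
  Real.tendsto_log_atTop.comp tendsto_natCast_atTop_atTop

theorem tendsto_log_log_natCast : Tendsto (fun n : ℕ => Real.log (Real.log n)) atTop atTop :=
  Real.tendsto_log_atTop.comp tendsto_log_natCast

/-- With `δ = (log n)^(-1/4)`, a round fails to bring most honest nodes to the same opinion with
probability at most `γ / (1 - 2 * β) + O(δ)`. -/
theorem eventually_round_failure_le (γ : ℝ) {β ε C : ℝ} (hε : 0 < ε)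
    (hC : 0 < C) :
    ∀ᶠ n : ℕ in atTop,
      (γ + 2 * Real.exp (-Real.log (Real.log n) / 4)) / (1 - 2 * β)
        + 2 * Real.exp (-2 * (⌈C * Real.log n⌉₊ : ℕ)
          * Real.exp (-Real.log (Real.log n) / 4) ^ 2) / ε
      ≤ γ / (1 - 2 * β)
        + (2 / (1 - 2 * β) + 1 / (ε * C)) * Real.exp (-Real.log (Real.log n) / 4) := by
  filter_upwards [tendsto_log_log_natCast.eventually_ge_atTop 0,
    tendsto_log_natCast.eventually_gt_atTop 0] with n hy hx
  set y := Real.log (Real.log n) with hydef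
  have hxy : Real.log n = Real.exp y := (Real.exp_log hx).symm
  have h1 : Real.exp (-2 * (⌈C * Real.log n⌉₊ : ℕ) * Real.exp (-y / 4) ^ 2)
      ≤ Real.exp (-(2 * C * Real.exp (y / 2))) := by
    have hk : C * Real.log n ≤ (⌈C * Real.log n⌉₊ : ℕ) := Nat.le_ceil _
    have hd : Real.exp (-y / 4) ^ 2 = Real.exp (-y / 2) := by
      rw [← Real.exp_nat_mul]; congr 1; push_cast; ring
    have hd2 : Real.log n * Real.exp (-y / 2) = Real.exp (y / 2) := by
      rw [hxy, ← Real.exp_add]; congr 1; ring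
    rw [Real.exp_le_exp, hd, ← hd2]
    have := mul_le_mul_of_nonneg_right hk (Real.exp_pos (-y / 2)).le
    linarith
  -- The Hoeffding term decays much faster than `δ = exp (-y / 4)`; the crude bound `exp (-z) ≤ 1 /
  -- z` already suffices.
  have h2 : Real.exp (-(2 * C * Real.exp (y / 2))) ≤ (2 * C)⁻¹ * Real.exp (-y / 4) := by
    refine (exp_neg_le_inv (by positivity)).trans ?_
    rw [mul_inv, ← Real.exp_neg]
    have : Real.exp (-(y / 2)) ≤ Real.exp (-y / 4) := Real.exp_le_exp.2 (by linarith)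
    gcongr
  have h3 : 2 * Real.exp (-2 * (⌈C * Real.log n⌉₊ : ℕ) * Real.exp (-y / 4) ^ 2) / ε
      ≤ 1 / (ε * C) * Real.exp (-y / 4) := by
    calc _ ≤ 2 * ((2 * C)⁻¹ * Real.exp (-y / 4)) / ε := by gcongr; exact h1.trans h2
      _ = _ := by field_simp
  calc _ ≤ (γ + 2 * Real.exp (-y / 4)) / (1 - 2 * β) + 1 / (ε * C) * Real.exp (-y / 4) := by
        gcongr
    _ = _ := by ring

/-- Common to both adversaries: `f` is the order of `m₀` and `exp (-g)` bounds the failure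
probability of a round. The condition `c * log n ≤ f * g` makes the power `ρ ^ (m₀ - 1)`
polynomially small. -/
theorem eventually_failure_le {ε C : ℝ} (hC : 0 < C) (hCε : 3 ≤ 2 * C * ε ^ 2) (ℓ : ℕ)
    {m₀ : ℕ → ℕ} {f g ρ : ℕ → ℝ} (hm : (fun n => (m₀ n : ℝ)) =Θ[atTop] f)
    (hf : Tendsto f atTop atTop) (hfle : ∀ᶠ n : ℕ in atTop, f n ≤ Real.log n)
    (hρ0 : ∀ᶠ n in atTop, 0 ≤ ρ n) (hρ : ∀ᶠ n in atTop, ρ n ≤ Real.exp (-g n))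
    {c : ℝ} (hc : 0 < c) (hg : ∀ᶠ n in atTop, 0 ≤ g n)
    (hfg : ∀ᶠ n : ℕ in atTop, c * Real.log n ≤ f n * g n) :
    ∃ h K : ℝ, 0 < h ∧ 0 < K ∧ ∀ᶠ n : ℕ in atTop,
      ((m₀ n + ℓ : ℕ) : ℝ) * (2 * n * (⌈C * Real.log n⌉₊ : ℕ)) ≤ K * (n * (Real.log n * f n)) ∧
      ρ n ^ (m₀ n - 1)
        + 2 * (m₀ n + ℓ : ℕ) * (n * Real.exp (-2 * (⌈C * Real.log n⌉₊ : ℕ) * ε ^ 2))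
        ≤ K * (n : ℝ) ^ (-h) := by
  obtain ⟨c₁, hc₁, h₁⟩ := hm.2.exists_pos
  obtain ⟨c₂, hc₂, h₂⟩ := hm.1.exists_pos
  -- The `1` comes from the union bound over rounds. The other term comes from the power, where `f ≤
  -- c₁ m₀`, and the `2` pays for `m₀ - 1 ≥ m₀ / 2`.
  set h := min 1 (c / (2 * c₁)) with hh
  have hh0 : 0 < h := lt_min one_pos (by positivity)
  refine ⟨h, 2 * (c₂ + 1) * (C + 1) + 1, hh0, by positivity, ?_⟩
  filter_upwards [h₁.bound, h₂.bound, hf.eventually_ge_atTop (ℓ : ℝ), hfle, hρ0, hρ, hg, hfg,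
    hf.eventually_ge_atTop (2 * c₁), eventually_ge_atTop 1,
    tendsto_log_natCast.eventually_ge_atTop 1]
    with n h₁ h₂ hℓ hfle hρ0 hρ hg hfg hf1 hn hx
  have hfpos : 0 < f n := lt_of_lt_of_le (by positivity) hf1
  rw [Real.norm_of_nonneg hfpos.le, Real.norm_of_nonneg (Nat.cast_nonneg _)] at h₁ h₂
  have hn0 : (0 : ℝ) < n := by exact_mod_cast hn
  set x := Real.log n with hxdef
  have hnx : (n : ℝ) = Real.exp x := (Real.exp_log hn0).symm
  set k := ⌈C * x⌉₊
  have hk1 : C * x ≤ k := Nat.le_ceil _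
  have hk2 : (k : ℝ) ≤ (C + 1) * x := by
    have := (Nat.ceil_lt_add_one (a := C * x) (by positivity)).le
    linarith
  have hT : ((m₀ n + ℓ : ℕ) : ℝ) ≤ (c₂ + 1) * f n := by push_cast; linarith
  constructor
  · calc ((m₀ n + ℓ : ℕ) : ℝ) * (2 * n * k) ≤ ((c₂ + 1) * f n) * (2 * n * ((C + 1) * x)) := by
          gcongr
      _ = 2 * (c₂ + 1) * (C + 1) * (n * (x * f n)) := by ring
      _ ≤ _ := by
          have : 0 ≤ (n : ℝ) * (x * f n) := by positivity
          linarith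
  · have hpow : (n : ℝ) ^ (-h) = Real.exp (-(h * x)) := by
      rw [Real.rpow_def_of_pos hn0]; congr 1; simp only [← hxdef]; ring
    have hA : ρ n ^ (m₀ n - 1) ≤ Real.exp (-(h * x)) := by
      have hm2 : (2 : ℝ) ≤ m₀ n := by
        have : c₁ * 2 ≤ c₁ * m₀ n := by linarith
        exact le_of_mul_le_mul_left this hc₁
      have hm2' : 2 ≤ m₀ n := by exact_mod_cast hm2
      have hm3 : (m₀ n : ℝ) / 2 ≤ (m₀ n - 1 : ℕ) := by
        rw [Nat.cast_sub (by omega)]; push_cast; linarith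
      refine (pow_le_pow_left₀ hρ0 hρ _).trans ?_
      rw [← Real.exp_nat_mul, Real.exp_le_exp, mul_neg, neg_le_neg_iff]
      have h3 : c * x ≤ c₁ * m₀ n * g n := hfg.trans (mul_le_mul_of_nonneg_right h₁ hg)
      have h4 : c / (2 * c₁) * x ≤ (m₀ n : ℝ) / 2 * g n := by
        rw [div_mul_eq_mul_div, div_le_iff₀ (by positivity)]
        linarith
      have h5 : h * x ≤ c / (2 * c₁) * x :=
        mul_le_mul_of_nonneg_right (min_le_right _ _) (by linarith)
      exact h5.trans (h4.trans (mul_le_mul_of_nonneg_right hm3 hg))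
    -- By `3 ≤ 2 * C * ε ^ 2` the exponential is at most `n⁻³`. One factor `n` is lost to the nodes
    -- here, and another to the number of rounds below.
    have hB : (n : ℝ) * Real.exp (-2 * k * ε ^ 2) ≤ Real.exp (-(2 * x)) := by
      rw [hnx, ← Real.exp_add, Real.exp_le_exp]
      have h6 : C * x * ε ^ 2 ≤ k * ε ^ 2 := mul_le_mul_of_nonneg_right hk1 (sq_nonneg _)
      have h7 : 3 * x ≤ 2 * C * ε ^ 2 * x := mul_le_mul_of_nonneg_right hCε (by linarith)
      linarith
    have hxe : x ≤ Real.exp x := by linarith [Real.add_one_le_exp x]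
    have hC' : 2 * ((m₀ n + ℓ : ℕ) : ℝ) * (n * Real.exp (-2 * k * ε ^ 2))
        ≤ 2 * (c₂ + 1) * Real.exp (-(h * x)) := by
      calc _ ≤ 2 * ((c₂ + 1) * Real.exp x) * Real.exp (-(2 * x)) := by
            have : ((m₀ n + ℓ : ℕ) : ℝ) ≤ (c₂ + 1) * Real.exp x :=
              hT.trans (mul_le_mul_of_nonneg_left (hfle.trans hxe) (by positivity))
            gcongr
        _ = 2 * (c₂ + 1) * Real.exp (-x) := by
            rw [show -x = x + -(2 * x) by ring, Real.exp_add]; ring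
        _ ≤ _ := by
            have : h * x ≤ x := by
              have := mul_le_mul_of_nonneg_right (min_le_left 1 (c / (2 * c₁)))
                (by linarith : 0 ≤ x)
              linarith
            gcongr
    rw [hpow]
    have he := Real.exp_pos (-(h * x))
    have : 0 ≤ 2 * (c₂ + 1) * C * Real.exp (-(h * x)) := by positivity
    calc _ ≤ Real.exp (-(h * x)) + 2 * (c₂ + 1) * Real.exp (-(h * x)) := add_le_add hA hC'
      _ ≤ _ := by linarith

theorem tendsto_log_div_log_log :
    Tendsto (fun n : ℕ => Real.log n / Real.log (Real.log n)) atTop atTop := by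
  have h : Tendsto (fun y : ℝ => Real.exp y / y) atTop atTop := by
    simpa using Real.tendsto_exp_div_pow_atTop 1
  refine (h.comp tendsto_log_log_natCast).congr' ?_
  filter_upwards [tendsto_log_natCast.eventually_gt_atTop 0] with n hx
  simp [Real.exp_log hx]

end FPC

/-! ### Choice of constants for the two adversaries -/

theorem mainTheorem4 (q β : ℝ) (hq : 0 ≤ q) (hqβ : q < β) (hβ : β < 1 / 2) :
    -- cautious adversary
    (∃ C₀ : ℝ, 0 < C₀ ∧ ∀ C : ℝ, C₀ ≤ C → ∀ a b : ℝ, 1 / 2 < a → a ≤ b → b < 1 →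
      ∀ ℓ : ℕ, 1 ≤ ℓ → ∀ m₀ : ℕ → ℕ,
      ((fun n => (m₀ n : ℝ)) =Θ[atTop]
        fun n : ℕ => Real.log n / Real.log (Real.log n)) →
      ∃ h K : ℝ, 0 < h ∧ 0 < K ∧ ∀ᶠ n : ℕ in atTop,
        ∀ (A : Finset (Fin n)), (A.card : ℝ) ≤ q * n → ∀ init : Fin n → Bool,
        ∀ (S : Type*) [MeasurableSpace S] (μ : Measure S) [IsProbabilityMeasure μ],
        ∀ σ : FPC.Strategy n ⌈C * Real.log n⌉₊ S, σ.IsCautious A →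
        (μ.prod (FPC.roundsLaw ⟨⌈C * Real.log n⌉₊, a, b, β, m₀ n, ℓ⟩ n)).real
          (FPC.success ⟨⌈C * Real.log n⌉₊, a, b, β, m₀ n, ℓ⟩ A σ init (m₀ n + ℓ)
            (K * (n * Real.log n ^ 2 / Real.log (Real.log n))))ᶜ
          ≤ K * (n : ℝ) ^ (-h)) ∧
    -- berserk adversary
    (q < 1 - 2 * β →
      ∃ C₀ : ℝ, 0 < C₀ ∧ ∀ C : ℝ, C₀ ≤ C → ∀ a b : ℝ, 1 / 2 < a → a ≤ b → b < 1 →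
      ∀ ℓ : ℕ, 1 ≤ ℓ → ∀ m₀ : ℕ → ℕ,
      ((fun n => (m₀ n : ℝ)) =Θ[atTop] fun n : ℕ => Real.log n) →
      ∃ h K : ℝ, 0 < h ∧ 0 < K ∧ ∀ᶠ n : ℕ in atTop,
        ∀ (A : Finset (Fin n)), (A.card : ℝ) ≤ q * n → ∀ init : Fin n → Bool,
        ∀ (S : Type*) [MeasurableSpace S] (μ : Measure S) [IsProbabilityMeasure μ],
        ∀ σ : FPC.Strategy n ⌈C * Real.log n⌉₊ S,
        (μ.prod (FPC.roundsLaw ⟨⌈C * Real.log n⌉₊, a, b, β, m₀ n, ℓ⟩ n)).real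
          (FPC.success ⟨⌈C * Real.log n⌉₊, a, b, β, m₀ n, ℓ⟩ A σ init (m₀ n + ℓ)
            (K * (n * Real.log n ^ 2)))ᶜ
          ≤ K * (n : ℝ) ^ (-h)) := by
  have hε : 0 < (β - q) / 2 := by linarith
  have hb : 0 < 1 - 2 * β := by linarith
  set ε := (β - q) / 2 with hεdef
  have hC₀ : 0 < 3 / (2 * ε ^ 2) := by positivity
  have hCε : ∀ C, 3 / (2 * ε ^ 2) ≤ C → 3 ≤ 2 * C * ε ^ 2 := fun C hC => by
    rw [div_le_iff₀ (by positivity)] at hC; linarith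
  set ρ : ℝ → ℝ → ℕ → ℝ := fun γ C n =>
    (γ + 2 * Real.exp (-Real.log (Real.log n) / 4)) / (1 - 2 * β)
      + 2 * Real.exp (-2 * (⌈C * Real.log n⌉₊ : ℕ)
        * Real.exp (-Real.log (Real.log n) / 4) ^ 2) / ε with hρdef
  have hρ0 : ∀ γ C n, 0 ≤ γ → 0 ≤ ρ γ C n := fun γ C n hγ => by simp only [hρdef]; positivity
  have hδ0 : Tendsto (fun n : ℕ => Real.exp (-Real.log (Real.log n) / 4)) atTop (nhds 0) := by
    have : Tendsto (fun n : ℕ => Real.log (Real.log n) / 4) atTop atTop :=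
      FPC.tendsto_log_log_natCast.atTop_div_const (by norm_num)
    refine (Real.tendsto_exp_neg_atTop_nhds_zero.comp this).congr fun n => ?_
    simp only [Function.comp, neg_div]
  refine ⟨⟨3 / (2 * ε ^ 2), hC₀, fun C hC a b _ _ _ ℓ hℓ m₀ hm => ?_⟩,
    fun hqb => ⟨3 / (2 * ε ^ 2), hC₀, fun C hC a b _ _ _ ℓ hℓ m₀ hm => ?_⟩⟩
  · have hCpos := hC₀.trans_le hC
    -- Half of the exponent in `δ = (log n)^(-1/4)` absorbs the constant factor, which leaves `(log
    -- n)^(-1/8)`.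
    have hρ : ∀ᶠ n : ℕ in atTop, ρ 0 C n ≤ Real.exp (-(Real.log (Real.log n) / 8)) := by
      have hK : Tendsto (fun n : ℕ => Real.exp (Real.log (Real.log n) / 8)) atTop atTop :=
        Real.tendsto_exp_atTop.comp
          (FPC.tendsto_log_log_natCast.atTop_div_const (by norm_num))
      filter_upwards [FPC.eventually_round_failure_le 0 hε hCpos,
        hK.eventually_ge_atTop (2 / (1 - 2 * β) + 1 / (ε * C))] with n h1 h2
      refine h1.trans ?_
      rw [zero_div, zero_add]
      refine (mul_le_mul_of_nonneg_right h2 (Real.exp_pos _).le).trans (le_of_eq ?_)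
      rw [← Real.exp_add]; congr 1; ring
    obtain ⟨h, K, hh, hK, hev⟩ := FPC.eventually_failure_le hCpos (hCε C hC) ℓ hm
      FPC.tendsto_log_div_log_log (by
        filter_upwards [FPC.tendsto_log_log_natCast.eventually_ge_atTop 1,
          FPC.tendsto_log_natCast.eventually_ge_atTop 0] with n hy hx
        exact div_le_self hx hy)
      (Eventually.of_forall fun n => hρ0 0 C n le_rfl) hρ (c := 1 / 8) (by norm_num) (by
        filter_upwards [FPC.tendsto_log_log_natCast.eventually_ge_atTop 0] with n hy
        positivity) (by
        filter_upwards [FPC.tendsto_log_log_natCast.eventually_gt_atTop 0] with n hy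
        apply le_of_eq
        field_simp)
    refine ⟨h, K, hh, hK, ?_⟩
    filter_upwards [hev, eventually_ge_atTop 1,
      FPC.tendsto_log_natCast.eventually_gt_atTop 0] with n hn hn1 hx A hA init S _ μ _ σ hσ
    have : NeZero n := ⟨by omega⟩
    refine le_trans ?_ hn.2
    exact FPC.measureReal_compl_success_le ⟨⌈C * Real.log n⌉₊, a, b, β, m₀ n, ℓ⟩ A σ init μ
      (γ := 0) le_rfl (Real.exp_pos _).le hqβ hβ (Nat.ceil_pos.2 (by positivity)) hℓ hA
      (hn.1.trans (le_of_eq (by ring)))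
      (fun s st m h => FPC.sandwiched_of_isCautious hσ st m s h)
  · have hCpos := hC₀.trans_le hC
    have hγ : q / (1 - 2 * β) < 1 := (div_lt_one hb).2 hqb
    have hγ0 : 0 ≤ q / (1 - 2 * β) := by positivity
    -- The midpoint between `1` and `q / (1 - 2 * β)`, the limit of the bound on the failure
    -- probability of a round.
    set ρ₀ := (1 + q / (1 - 2 * β)) / 2 with hρ₀
    have hρ₀pos : 0 < ρ₀ := by linarith
    have hρ₀lt : ρ₀ < 1 := by linarith
    have hlog : 0 < -Real.log ρ₀ := neg_pos.2 (Real.log_neg hρ₀pos hρ₀lt)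
    have hρ : ∀ᶠ n : ℕ in atTop, ρ q C n ≤ Real.exp (-(-Real.log ρ₀)) := by
      have hlim := (hδ0.const_mul (2 / (1 - 2 * β) + 1 / (ε * C))).const_add (q / (1 - 2 * β))
      rw [mul_zero, add_zero] at hlim
      filter_upwards [FPC.eventually_round_failure_le q hε hCpos,
        hlim.eventually_le_const (show q / (1 - 2 * β) < ρ₀ by linarith)] with n h1 h2
      rw [neg_neg, Real.exp_log hρ₀pos]
      exact h1.trans h2
    obtain ⟨h, K, hh, hK, hev⟩ := FPC.eventually_failure_le hCpos (hCε C hC) ℓ hm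
      FPC.tendsto_log_natCast (Eventually.of_forall fun n => le_rfl)
      (Eventually.of_forall fun n => hρ0 q C n hq) hρ hlog
      (Eventually.of_forall fun _ => hlog.le)
      (Eventually.of_forall fun n => (mul_comm _ _).le)
    refine ⟨h, K, hh, hK, ?_⟩
    filter_upwards [hev, eventually_ge_atTop 1,
      FPC.tendsto_log_natCast.eventually_gt_atTop 0] with n hn hn1 hx A hA init S _ μ _ σ
    have : NeZero n := ⟨by omega⟩
    refine le_trans ?_ hn.2
    exact FPC.measureReal_compl_success_le ⟨⌈C * Real.log n⌉₊, a, b, β, m₀ n, ℓ⟩ A σ init μ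
      (γ := q) hq (Real.exp_pos _).le hqβ hβ (Nat.ceil_pos.2 (by positivity)) hℓ hA
      (hn.1.trans (le_of_eq (by ring)))
      (fun s st m h => FPC.sandwiched_of_card_le hA st _)
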